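/- For a distribution function $F$ on $\mathbb R$ let $F^{-1}(u)=\inf\{x:F(x)\ge u\}$ for $0<u\le 1$ and $F^{-1}(0)=F^{-1}(0+)$. Write $F\in D(M)$ if there are $a_n>0$, $b_n\in\mathbb R$ with $F(a_nx+b_n)^n\to M(x)$ at every continuity point $x$ of $M$. Let $\Lambda(x)=\exp(-e^{-x})$, let $\phi_\gamma(x)=\exp(-x^{-\gamma})$ for $x>0$ and $\phi_\gamma(x)=0$ for $x\le 0$ ($\gamma>0$), and let $D(\phi)=\bigcup_{\gamma>0}D(\phi_\gamma)$. For i.i.d. random variables $X_1,X_2,\dots$ with distribution function $F$, $F(1)=0$, let $Y_{1,n}\le\dots\le Y_{n,n}$ be the order statistics of $\log X_1,\dots,\log X_n$, and for $1<k<n$ put $$C_n=\frac{Y_{n,n}-Y_{n-k,n}}{\log k}.$$ Say that a sequence $k=k_n$ of positive integers satisfies (K) if $k_n\to\infty$ and $k_n/n\to0$. (a) There is a distribution function $G$ with $$G^{-1}(1-2^{-m})=m,\qquad G^{-1}(1-u)=m+(2^{-m}-u)\,2^{m+1}\quad\text{for }2^{-m-1}<u<2^{-m},\qquad m=0,1,2,\dots,$$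 such that $F$, defined by $F(x)=G(\log x)$ for $x>0$ and $F(x)=0$ for $x\le0$, is a distribution function with $F(1)=0$, and $F\notin D(\phi)$, $F\notin D(\Lambda)$, $G\notin D(\phi)$, $G\notin D(\Lambda)$. Nevertheless, for every i.i.d. sequence $X_1,X_2,\dots$ with distribution function $F$ and every sequence $k$ satisfying (K), $C_n\to 1/\log 2$ in probability as $n\to\infty$. (b) Consequently, for an i.i.d. sequence with distribution function $F$, $F(1)=0$, the convergence in probability of $C_n$ to one positive real number for all sequences $k$ satisfying (K) does not imply $F\in D(\phi)$. (c) In particular, $C_n$ does not empirically characterize $D(\phi_\gamma)$: for $\gamma=\log 2$ it is not true that, for all i.i.d. sequences with distribution function $F$, $F(1)=0$, one has $F\in D(\phi_\gamma)$ if and only if $C_n\to1/\gamma$ in probability for all sequences $k$ satisfying (K). -/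

import Mathlib

open MeasureTheory ProbabilityTheory Filter Topology

noncomputable section

/-- `F` is a (cumulative) distribution function on the real line. -/
def IsDistributionFunction (F : ℝ → ℝ) : Prop :=
  Monotone F ∧ (∀ x, ContinuousWithinAt F (Set.Ici x) x) ∧
    Tendsto F atBot (𝓝 0) ∧ Tendsto F atTop (𝓝 1)

/-- The generalized inverse of `F`: `F⁻¹(u) = inf {x | F x ≥ u}` for `0 < u`, and
`F⁻¹(0) = F⁻¹(0+)` is the right limit at `0`. -/
def quantile (F : ℝ → ℝ) (u : ℝ) : ℝ :=
  if u = 0 then Function.rightLim (fun v : ℝ => sInf {x : ℝ | v ≤ F x}) 0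
  else sInf {x : ℝ | u ≤ F x}

/-- The Fréchet distribution function with parameter `γ`. -/
def frechet (γ : ℝ) (x : ℝ) : ℝ :=
  if 0 < x then Real.exp (-(x ^ (-γ))) else 0

/-- The Gumbel distribution function. -/
def gumbel (x : ℝ) : ℝ := Real.exp (-Real.exp (-x))

/-- `F ∈ D(M)`: for some `a n > 0` and `b n`, `F (a n * x + b n) ^ n → M x` at every
continuity point `x` of `M`. -/
def InDomainOfAttraction (F M : ℝ → ℝ) : Prop :=
  ∃ a b : ℕ → ℝ, (∀ n, 0 < a n) ∧
    ∀ x, ContinuousAt M x → Tendsto (fun n : ℕ => F (a n * x + b n) ^ n) atTop (𝓝 (M x))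

/-- `F ∈ D(φ)`, that is, `F ∈ D(φ_γ)` for some `γ > 0`. -/
def InFrechetDomain (F : ℝ → ℝ) : Prop :=
  ∃ γ : ℝ, 0 < γ ∧ InDomainOfAttraction F (frechet γ)

/-- `F(x) = G(log x)`, the distribution function of `exp Y` when `Y` has distribution
function `G`; it vanishes for `x ≤ 0`. -/
def compLog (G : ℝ → ℝ) (x : ℝ) : ℝ := if 0 < x then G (Real.log x) else 0

/-- `X 0, X 1, …` are independent random variables with common distribution function `F`. -/
def IsIIDWithDF {Ω : Type*} [MeasurableSpace Ω] (μ : Measure Ω) (X : ℕ → Ω → ℝ)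
    (F : ℝ → ℝ) : Prop :=
  (∀ i, Measurable (X i)) ∧ iIndepFun X μ ∧ ∀ i x, μ.real {ω | X i ω ≤ x} = F x

/-- The `j`-th smallest (`1 ≤ j ≤ n`) of the first `n` terms of the sequence `y`
(counted with multiplicity); junk value `0` for other `j`. -/
def orderStat (y : ℕ → ℝ) (j n : ℕ) : ℝ :=
  if h : 1 ≤ j ∧ j ≤ n then
    (fun i : Fin n => y i) (Tuple.sort (fun i : Fin n => y i) ⟨j - 1, by omega⟩)
  else 0

/-- The de Haan–Resnick statistic `(Y_{n,n} - Y_{n-k,n}) / log k` of the sample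
`y 0, …, y (n-1)`. -/
def deHaanResnick (y : ℕ → ℝ) (n k : ℕ) : ℝ :=
  (orderStat y n n - orderStat y (n - k) n) / Real.log k

/-- Condition (K): `k n → ∞` and `k n / n → 0`. -/
def ConditionK (k : ℕ → ℕ) : Prop :=
  Tendsto k atTop atTop ∧ Tendsto (fun n : ℕ => (k n : ℝ) / n) atTop (𝓝 0)

/-- For all sequences `k` satisfying (K), the statistic `S (Y_1, Y_2, …) n (k n)` of the
logarithms `Y_i = log X_i` converges in probability to `c`. -/
def ConvergesForAllK {Ω : Type*} [MeasurableSpace Ω] (μ : Measure Ω) (X : ℕ → Ω → ℝ)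
    (S : (ℕ → ℝ) → ℕ → ℕ → ℝ) (c : ℝ) : Prop :=
  ∀ k : ℕ → ℕ, ConditionK k →
    TendstoInMeasure μ (fun n ω => S (fun i => Real.log (X i ω)) n (k n)) atTop (fun _ => c)

/-- The statistic `S` empirically characterizes `D(φ_γ)`: an i.i.d. sequence with distribution
function `F`, `F 1 = 0`, has `F ∈ D(φ_γ)` if and only if `S` converges in probability to `1 / γ`
for all sequences `k` satisfying (K). -/
def EmpiricallyCharacterizesFrechet (S : (ℕ → ℝ) → ℕ → ℕ → ℝ) (γ : ℝ) : Prop :=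
  ∀ (Ω : Type) (_ : MeasurableSpace Ω) (μ : Measure Ω) (_ : IsProbabilityMeasure μ)
    (X : ℕ → Ω → ℝ) (F : ℝ → ℝ), IsIIDWithDF μ X F → F 1 = 0 →
    (InDomainOfAttraction F (frechet γ) ↔ ConvergesForAllK μ X S (1 / γ))

end

/-! The tail of `dyadicDF` lies between `2 ^ (-t)` and `2 * 2 ^ (-t)` for `t ≥ 0`. Up to a bounded
factor it is an exponential tail, and `log k → ∞` makes that factor invisible: by a Markov and a
Chernoff bound for the number of exceedances, `Y_{n,n} = log n / log 2 + o(log k)` and `Y_{n-k,n} =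
log (n / k) / log 2 + o(log k)` in probability. Subtracting gives the limit `1 / log 2`. Extreme
value limits do see the factor. Along sample sizes `2 ^ m` the tail is self-similar under the shift
by `m`, so attraction to `M` would make the quantiles of `M` at the levels `exp (-s)` affine images
of those of the tail (`tendsto_sub_div_of_tendsto_pow`). Linear interpolation makes these
equidistant at `s = 1, 3/4, 1/2`; for `compLog dyadicDF` they grow geometrically. Neither the Gumbel
nor any Fréchet law has such quantiles. -/

/-! ### The distribution function `dyadicDF` and its quantiles -/

/-- The survival function: it interpolates the values `2 ^ (-m)` at the natural numbers `m`
linearly. -/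
noncomputable def dyadicTail (x : ℝ) : ℝ := (1 / 2 : ℝ) ^ ⌊x⌋₊ * (1 - (x - ⌊x⌋₊) / 2)

/-- The distribution function with survival function `dyadicTail` on the positive half-line. -/
noncomputable def dyadicDF (x : ℝ) : ℝ := max 0 (1 - dyadicTail x)

theorem dyadicTail_eq {m : ℕ} {x : ℝ} (h₁ : (m : ℝ) ≤ x) (h₂ : x < m + 1) :
    dyadicTail x = (1 / 2 : ℝ) ^ m * (1 - (x - m) / 2) := by
  have : ⌊x⌋₊ = m := (Nat.floor_eq_iff ((Nat.cast_nonneg m).trans h₁)).2 ⟨h₁, h₂⟩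
  rw [dyadicTail, this]

theorem dyadicTail_natCast (m : ℕ) : dyadicTail m = (1 / 2 : ℝ) ^ m := by
  rw [dyadicTail_eq le_rfl (by linarith)]; ring

theorem dyadicTail_natCast_add_half (m : ℕ) :
    dyadicTail (m + 1 / 2) = 3 / 4 * (1 / 2 : ℝ) ^ m := by
  rw [dyadicTail_eq (m := m) (by linarith) (by linarith)]; ring

/-- Since `⌊x⌋₊ = 0` also for negative `x`, the first linear piece continues to the left with values
above `1`; this is why `dyadicDF` is cut off at `0`. -/
theorem dyadicTail_of_lt_one {x : ℝ} (hx : x < 1) : dyadicTail x = 1 - x / 2 := by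
  have : ⌊x⌋₊ = 0 := Nat.floor_eq_zero.2 hx
  simp [dyadicTail, this]

theorem lt_dyadicTail (x : ℝ) : (1 / 2 : ℝ) ^ (⌊x⌋₊ + 1) < dyadicTail x := by
  have h := Nat.lt_floor_add_one x
  have hp : (0 : ℝ) < (1 / 2 : ℝ) ^ ⌊x⌋₊ := by positivity
  rw [dyadicTail, pow_succ]
  exact mul_lt_mul_of_pos_left (by linarith) hp

theorem dyadicTail_pos (x : ℝ) : 0 < dyadicTail x :=
  lt_trans (by positivity) (lt_dyadicTail x)

theorem dyadicTail_le {x : ℝ} (hx : 0 ≤ x) : dyadicTail x ≤ (1 / 2 : ℝ) ^ ⌊x⌋₊ := by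
  have h := Nat.floor_le hx
  have hp : (0 : ℝ) < (1 / 2 : ℝ) ^ ⌊x⌋₊ := by positivity
  rw [dyadicTail]
  exact mul_le_of_le_one_right hp.le (by linarith)

theorem strictAnti_dyadicTail : StrictAnti dyadicTail := by
  intro x y hxy
  rcases (Nat.floor_mono hxy.le).eq_or_lt with h | h
  · have hp : (0 : ℝ) < (1 / 2 : ℝ) ^ ⌊x⌋₊ := by positivity
    rw [dyadicTail, dyadicTail, ← h]
    exact mul_lt_mul_of_pos_left (by linarith) hp
  · have hy : 0 ≤ y := by
      by_contra hy
      rw [Nat.floor_of_nonpos (by linarith : y ≤ 0)] at h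
      omega
    calc dyadicTail y ≤ (1 / 2 : ℝ) ^ ⌊y⌋₊ := dyadicTail_le hy
      _ ≤ (1 / 2 : ℝ) ^ (⌊x⌋₊ + 1) :=
        pow_le_pow_of_le_one (by norm_num) (by norm_num) h
      _ < dyadicTail x := lt_dyadicTail x

theorem dyadicTail_zero : dyadicTail 0 = 1 := by
  simpa using dyadicTail_natCast 0

theorem dyadicDF_of_nonpos {x : ℝ} (hx : x ≤ 0) : dyadicDF x = 0 := by
  have := strictAnti_dyadicTail.antitone hx
  rw [dyadicTail_zero] at this
  exact max_eq_left (by linarith)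

theorem dyadicDF_of_nonneg {x : ℝ} (hx : 0 ≤ x) : dyadicDF x = 1 - dyadicTail x := by
  have := strictAnti_dyadicTail.antitone hx
  rw [dyadicTail_zero] at this
  exact max_eq_right (by linarith)

theorem dyadicDF_nonneg (x : ℝ) : 0 ≤ dyadicDF x := le_max_left _ _

theorem monotone_dyadicDF : Monotone dyadicDF := fun x y h =>
  max_le_max le_rfl (by linarith [strictAnti_dyadicTail.antitone h])

theorem continuousWithinAt_dyadicTail (x : ℝ) :
    ContinuousWithinAt dyadicTail (Set.Ici x) x := by
  have hc : ContinuousWithinAt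
      (fun y : ℝ => (1 / 2 : ℝ) ^ ⌊x⌋₊ * (1 - (y - ⌊x⌋₊) / 2)) (Set.Ici x) x := by
    apply Continuous.continuousWithinAt
    fun_prop
  refine hc.congr_of_eventuallyEq ?_ rfl
  filter_upwards [Ico_mem_nhdsGE (Nat.lt_floor_add_one x)] with y hy
  have : ⌊y⌋₊ = ⌊x⌋₊ := by
    apply le_antisymm
    · exact Nat.lt_succ_iff.1 ((Nat.floor_lt' (Nat.succ_ne_zero _)).2 (by exact_mod_cast hy.2))
    · exact Nat.floor_mono hy.1
  rw [dyadicTail, this]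

theorem tendsto_dyadicTail_atTop : Tendsto dyadicTail atTop (𝓝 0) := by
  have h : Tendsto (fun x : ℝ => (1 / 2 : ℝ) ^ ⌊x⌋₊) atTop (𝓝 0) :=
    (tendsto_pow_atTop_nhds_zero_of_lt_one (by norm_num) (by norm_num)).comp tendsto_nat_floor_atTop
  refine squeeze_zero' (Eventually.of_forall fun x => (dyadicTail_pos x).le) ?_ h
  filter_upwards [eventually_ge_atTop 0] with x hx using dyadicTail_le hx

theorem isDistributionFunction_dyadicDF : IsDistributionFunction dyadicDF := by
  refine ⟨monotone_dyadicDF, fun x => ?_, ?_, ?_⟩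
  · exact continuousWithinAt_const.max
      (continuousWithinAt_const.sub (continuousWithinAt_dyadicTail x))
  · refine tendsto_const_nhds.congr' ?_
    filter_upwards [eventually_le_atBot 0] with x hx using (dyadicDF_of_nonpos hx).symm
  · have : Tendsto (fun x => 1 - dyadicTail x) atTop (𝓝 (1 - 0)) :=
      tendsto_const_nhds.sub tendsto_dyadicTail_atTop
    rw [sub_zero] at this
    refine this.congr' ?_
    filter_upwards [eventually_ge_atTop 0] with x hx using (dyadicDF_of_nonneg hx).symm

/-- Strict monotonicity on the positive half-line makes the set exactly `Set.Ici x`, so no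
continuity is needed to invert. -/
theorem sInf_setOf_le_dyadicDF {x : ℝ} (hx : 0 < x) :
    sInf {y | dyadicDF x ≤ dyadicDF y} = x := by
  have : {y | dyadicDF x ≤ dyadicDF y} = Set.Ici x := by
    ext y
    refine ⟨fun h => ?_, fun h => monotone_dyadicDF h⟩
    by_contra hyx
    have hyx : y < x := not_le.1 hyx
    have h1 : 1 - dyadicTail x ≤ dyadicDF y := by rw [← dyadicDF_of_nonneg hx.le]; exact h
    have h2 := strictAnti_dyadicTail hx
    rw [dyadicTail_zero] at h2
    rcases le_max_iff.1 h1 with h3 | h3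
    · linarith
    · linarith [strictAnti_dyadicTail hyx]
  rw [this, csInf_Ici]

theorem quantile_dyadicDF {x : ℝ} (hx : 0 < x) : quantile dyadicDF (1 - dyadicTail x) = x := by
  have h2 := strictAnti_dyadicTail hx
  rw [dyadicTail_zero] at h2
  rw [quantile, if_neg (by linarith), ← dyadicDF_of_nonneg hx.le]
  exact sInf_setOf_le_dyadicDF hx

theorem quantile_dyadicDF_zero : quantile dyadicDF 0 = 0 := by
  rw [quantile, if_pos rfl]
  apply rightLim_eq_of_tendsto
  -- The tail has slope `-1/2` on `[0, 1)`, so the inverse is `v ↦ 2 * v` near `0`.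
  have : Tendsto (fun v : ℝ => 2 * v) (𝓝[>] 0) (𝓝 (2 * 0)) :=
    (continuous_const.mul continuous_id).continuousWithinAt
  rw [mul_zero] at this
  refine this.congr' ?_
  filter_upwards [Ioo_mem_nhdsGT (show (0 : ℝ) < 1 / 2 by norm_num)] with v hv
  have hv0 : 0 < 2 * v := by linarith [hv.1]
  have : dyadicDF (2 * v) = v := by
    rw [dyadicDF_of_nonneg hv0.le, dyadicTail_of_lt_one (by linarith [hv.2])]; ring
  conv_rhs => rw [← this]
  exact (sInf_setOf_le_dyadicDF hv0).symm

theorem quantile_dyadicDF_natCast (m : ℕ) :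
    quantile dyadicDF (1 - (1 / 2 : ℝ) ^ m) = m := by
  rcases Nat.eq_zero_or_pos m with rfl | hm
  · simpa using quantile_dyadicDF_zero
  · rw [← dyadicTail_natCast]
    exact quantile_dyadicDF (by exact_mod_cast hm)

theorem quantile_dyadicDF_of_mem_Ioo {m : ℕ} {u : ℝ} (h₁ : (1 / 2 : ℝ) ^ (m + 1) < u)
    (h₂ : u < (1 / 2 : ℝ) ^ m) :
    quantile dyadicDF (1 - u) = m + ((1 / 2 : ℝ) ^ m - u) * 2 ^ (m + 1) := by
  have hp : (1 / 2 : ℝ) ^ m * 2 ^ m = 1 := by rw [← mul_pow]; norm_num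
  have hq : (0 : ℝ) < 2 ^ m := by positivity
  set x : ℝ := m + ((1 / 2 : ℝ) ^ m - u) * 2 ^ (m + 1) with hx
  have hx' : x = m + 2 * (1 - u * 2 ^ m) := by
    rw [hx, pow_succ]; linear_combination 2 * hp
  have h3 : u * 2 ^ m < 1 := by rw [← hp]; exact mul_lt_mul_of_pos_right h₂ hq
  have h4 : 1 / 2 < u * 2 ^ m := by
    have := mul_lt_mul_of_pos_right h₁ hq
    rw [pow_succ] at this
    linarith
  have hu : dyadicTail x = u := by
    rw [dyadicTail_eq (m := m) (by linarith) (by linarith), hx']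
    linear_combination u * hp
  have := quantile_dyadicDF (x := x) (by linarith [(Nat.cast_nonneg m : (0 : ℝ) ≤ m)])
  rwa [hu] at this

/-! ### The distribution function `compLog dyadicDF` -/

theorem compLog_dyadicDF_of_le_one {x : ℝ} (hx : x ≤ 1) : compLog dyadicDF x = 0 := by
  rw [compLog]
  split_ifs with h
  · exact dyadicDF_of_nonpos (Real.log_nonpos h.le hx)
  · rfl

theorem isDistributionFunction_compLog_dyadicDF :
    IsDistributionFunction (compLog dyadicDF) := by
  have hmono : Monotone (compLog dyadicDF) := by
    intro x y h
    rcases le_or_gt x 0 with hx | hx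
    · rw [compLog_dyadicDF_of_le_one (by linarith), compLog]
      split_ifs
      exacts [dyadicDF_nonneg _, le_rfl]
    · rw [compLog, compLog, if_pos hx, if_pos (hx.trans_le h)]
      exact monotone_dyadicDF (Real.log_le_log hx h)
  refine ⟨hmono, fun x => ?_, ?_, ?_⟩
  · rcases le_or_gt x 0 with hx | hx
    · refine (continuousWithinAt_const (b := (0 : ℝ))).congr_of_eventuallyEq ?_
        (compLog_dyadicDF_of_le_one (by linarith))
      filter_upwards [Ico_mem_nhdsGE (show x < 1 by linarith)] with y hy
      exact compLog_dyadicDF_of_le_one hy.2.le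
    · have h : ContinuousWithinAt (fun y => dyadicDF (Real.log y)) (Set.Ici x) x :=
        (isDistributionFunction_dyadicDF.2.1 (Real.log x)).comp
          (Real.continuousAt_log hx.ne').continuousWithinAt
          (fun y hy => Real.log_le_log hx hy)
      refine h.congr (fun y hy => ?_) ?_
      · rw [compLog, if_pos (hx.trans_le hy)]
      · rw [compLog, if_pos hx]
  · refine tendsto_const_nhds.congr' ?_
    filter_upwards [eventually_le_atBot 1] with x hx using (compLog_dyadicDF_of_le_one hx).symm
  · refine (isDistributionFunction_dyadicDF.2.2.2.comp Real.tendsto_log_atTop).congr' ?_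
    filter_upwards [eventually_gt_atTop 0] with x hx
    rw [compLog, if_pos hx, Function.comp]

/-! ### Exponential bounds for the tail -/

theorem min_one_le_dyadicTail (t : ℝ) : min 1 ((1 / 2 : ℝ) ^ t) ≤ dyadicTail t := by
  rcases le_or_gt t 0 with ht | ht
  · refine (min_le_left _ _).trans ?_
    rw [← dyadicTail_zero]
    exact strictAnti_dyadicTail.antitone ht
  · refine (min_le_right _ _).trans ?_
    have h1 := Nat.floor_le ht.le
    have h2 := Nat.lt_floor_add_one t
    -- By convexity the chord over a unit interval lies above the exponential: Bernoulli's
    -- inequality with exponent in `[0, 1]`.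
    have hb : (1 / 2 : ℝ) ^ (t - ⌊t⌋₊) ≤ 1 - (t - ⌊t⌋₊) / 2 := by
      have := rpow_one_add_le_one_add_mul_self (s := -1 / 2) (p := t - ⌊t⌋₊)
        (by norm_num) (by linarith) (by linarith)
      norm_num at this ⊢
      linarith
    calc (1 / 2 : ℝ) ^ t = (1 / 2 : ℝ) ^ ⌊t⌋₊ * (1 / 2 : ℝ) ^ (t - ⌊t⌋₊) := by
          rw [← Real.rpow_natCast, ← Real.rpow_add (by norm_num)]; congr 1; ring
      _ ≤ _ := mul_le_mul_of_nonneg_left hb (by positivity)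

theorem one_sub_dyadicDF_le (t : ℝ) : 1 - dyadicDF t ≤ 2 * (1 / 2 : ℝ) ^ t := by
  rcases le_or_gt t 0 with ht | ht
  · have := Real.one_le_rpow_of_pos_of_le_one_of_nonpos (x := 1 / 2) (z := t)
      (by norm_num) (by norm_num) ht
    rw [dyadicDF_of_nonpos ht]; linarith
  · have h2 := Nat.lt_floor_add_one t
    have : (1 / 2 : ℝ) ^ ⌊t⌋₊ ≤ 2 * (1 / 2 : ℝ) ^ t := by
      have h := Real.rpow_le_rpow_of_exponent_ge (x := 1 / 2) (by norm_num) (by norm_num)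
        h2.le
      rw [Real.rpow_add (by norm_num), Real.rpow_one, Real.rpow_natCast] at h
      linarith [h]
    rw [dyadicDF_of_nonneg ht.le]
    linarith [dyadicTail_le ht.le]

theorem min_one_le_one_sub_dyadicDF (t : ℝ) :
    min 1 ((1 / 2 : ℝ) ^ t) ≤ 1 - dyadicDF t := by
  rcases le_or_gt t 0 with ht | ht
  · rw [dyadicDF_of_nonpos ht]; simp
  · rw [dyadicDF_of_nonneg ht.le]; linarith [min_one_le_dyadicTail t]

/-! ### Failure of the domain of attraction conditions -/

/-- Convergence of distribution functions forces convergence of normalized quantiles: comparing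
powers at points `z` on either side of `x` traps `w m`, by monotonicity of `F`. Strict monotonicity
of `M` is asked only on an open `U`, which is the whole line for Gumbel and the positive half-line
for Fréchet. -/
theorem tendsto_sub_div_of_tendsto_pow {F M : ℝ → ℝ} (hF : Monotone F) (h0 : ∀ x, 0 ≤ F x)
    {a b : ℕ → ℝ} (ha : ∀ n, 0 < a n)
    (h : ∀ x, ContinuousAt M x → Tendsto (fun n : ℕ => F (a n * x + b n) ^ n) atTop (𝓝 (M x)))
    {U : Set ℝ} (hU : IsOpen U) (hc : ContinuousOn M U) (hm : StrictMonoOn M U) {x : ℝ}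
    (hx : x ∈ U) {k : ℕ → ℕ} {w : ℕ → ℝ} (hk : Tendsto k atTop atTop)
    (hw : Tendsto (fun m => F (w m) ^ k m) atTop (𝓝 (M x))) :
    Tendsto (fun m => (w m - b (k m)) / a (k m)) atTop (𝓝 x) := by
  have hlim : ∀ y ∈ U, Tendsto (fun m => F (a (k m) * y + b (k m)) ^ k m) atTop (𝓝 (M y)) :=
    fun y hy => (h y (hc.continuousAt (hU.mem_nhds hy))).comp hk
  refine tendsto_order.2 ⟨fun y hy => ?_, fun y hy => ?_⟩
  · obtain ⟨l, hl, hlU⟩ := exists_Ioc_subset_of_mem_nhds (hU.mem_nhds hx) ⟨y, hy⟩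
    obtain ⟨z, hz, hzx⟩ := exists_between (max_lt hy hl)
    have hzU : z ∈ U := hlU ⟨(le_max_right _ _).trans_lt hz, hzx.le⟩
    filter_upwards [(hlim z hzU).eventually_lt hw (hm hzU hx hzx)] with m hlt
    have h1 : F (a (k m) * z + b (k m)) < F (w m) := lt_of_pow_lt_pow_left₀ _ (h0 _) hlt
    have h2 := hF.reflect_lt h1
    rw [lt_div_iff₀ (ha _)]
    nlinarith [ha (k m), (le_max_left _ _).trans_lt hz]
  · obtain ⟨l, hl, hlU⟩ := exists_Ico_subset_of_mem_nhds (hU.mem_nhds hx) ⟨y, hy⟩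
    obtain ⟨z, hxz, hz⟩ := exists_between (lt_min hy hl)
    have hzU : z ∈ U := hlU ⟨hxz.le, hz.trans_le (min_le_right _ _)⟩
    filter_upwards [hw.eventually_lt (hlim z hzU) (hm hx hzU hxz)] with m hlt
    have h1 : F (w m) < F (a (k m) * z + b (k m)) := lt_of_pow_lt_pow_left₀ _ (h0 _) hlt
    have h2 := hF.reflect_lt h1
    rw [div_lt_iff₀ (ha _)]
    nlinarith [ha (k m), hz.trans_le (min_le_left _ _)]

theorem tendsto_one_sub_mul_half_pow (s : ℝ) :
    Tendsto (fun m : ℕ => (1 - s * (1 / 2 : ℝ) ^ m) ^ 2 ^ m) atTop (𝓝 (Real.exp (-s))) := by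
  have h := (Real.tendsto_one_add_div_pow_exp (-s)).comp
    (tendsto_pow_atTop_atTop_of_one_lt (one_lt_two : 1 < 2))
  refine h.congr fun m => ?_
  simp only [Function.comp, Nat.cast_pow, Nat.cast_ofNat, one_div, inv_pow]
  congr 1
  ring

theorem tendsto_dyadicDF_natCast_add_pow {c s : ℝ} (hc : 0 ≤ c)
    (h : ∀ m : ℕ, dyadicTail (m + c) = s * (1 / 2 : ℝ) ^ m) :
    Tendsto (fun m : ℕ => dyadicDF (m + c) ^ 2 ^ m) atTop (𝓝 (Real.exp (-s))) := by
  refine (tendsto_one_sub_mul_half_pow s).congr fun m => ?_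
  rw [dyadicDF_of_nonneg (by positivity), h]

theorem tendsto_compLog_dyadicDF_exp_pow {c s : ℝ} (hc : 0 ≤ c)
    (h : ∀ m : ℕ, dyadicTail (m + c) = s * (1 / 2 : ℝ) ^ m) :
    Tendsto (fun m : ℕ => compLog dyadicDF (Real.exp (m + c)) ^ 2 ^ m) atTop
      (𝓝 (Real.exp (-s))) := by
  refine (tendsto_dyadicDF_natCast_add_pow hc h).congr fun m => ?_
  rw [compLog, if_pos (Real.exp_pos _), Real.log_exp]

theorem dyadicTail_natCast_add_zero (m : ℕ) : dyadicTail (m + 0) = 1 * (1 / 2 : ℝ) ^ m := by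
  rw [add_zero, dyadicTail_natCast, one_mul]

theorem dyadicTail_natCast_add_one (m : ℕ) : dyadicTail (m + 1) = 1 / 2 * (1 / 2 : ℝ) ^ m := by
  have := dyadicTail_natCast (m + 1)
  push_cast at this
  rw [this]; ring

theorem dyadicTail_natCast_add_two (m : ℕ) : dyadicTail (m + 2) = 1 / 4 * (1 / 2 : ℝ) ^ m := by
  have := dyadicTail_natCast (m + 2)
  push_cast at this
  rw [this]; ring

theorem compLog_dyadicDF_nonneg (x : ℝ) : 0 ≤ compLog dyadicDF x := by
  rw [compLog]
  split_ifs
  exacts [dyadicDF_nonneg _, le_rfl]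

/-- If `dyadicDF` is attracted to a law whose quantile function is `q` (as a function of
`-log` of the level), then `q` takes equidistant values at `1`, `3 / 4`, `1 / 2`. -/
theorem quantile_eq_of_inDomainOfAttraction_dyadicDF {M q : ℝ → ℝ} {U : Set ℝ} (hU : IsOpen U)
    (hc : ContinuousOn M U) (hm : StrictMonoOn M U)
    (hq : ∀ s, 0 < s → q s ∈ U ∧ M (q s) = Real.exp (-s))
    (h : InDomainOfAttraction dyadicDF M) :
    q (1 / 2) - q (3 / 4) = q (3 / 4) - q 1 := by
  obtain ⟨a, b, ha, hab⟩ := h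
  have key : ∀ c s : ℝ, 0 ≤ c → 0 < s →
      (∀ m : ℕ, dyadicTail (m + c) = s * (1 / 2 : ℝ) ^ m) →
      Tendsto (fun m : ℕ => ((m + c) - b (2 ^ m)) / a (2 ^ m)) atTop (𝓝 (q s)) := by
    intro c s hc0 hs ht
    refine tendsto_sub_div_of_tendsto_pow monotone_dyadicDF dyadicDF_nonneg ha hab hU hc hm
      (hq s hs).1 (tendsto_pow_atTop_atTop_of_one_lt one_lt_two) ?_
    rw [(hq s hs).2]
    exact tendsto_dyadicDF_natCast_add_pow hc0 ht
  have h0 := key 0 1 le_rfl one_pos dyadicTail_natCast_add_zero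
  have h1 := key (1 / 2) (3 / 4) (by norm_num) (by norm_num) dyadicTail_natCast_add_half
  have h2 := key 1 (1 / 2) (by norm_num) (by norm_num) dyadicTail_natCast_add_one
  -- In the differences `b` cancels, and both equal `(1 / 2) / a (2 ^ m)`.
  refine tendsto_nhds_unique (h2.sub h1) ((h1.sub h0).congr fun m => ?_)
  ring

/-- If `compLog dyadicDF` is attracted to a law whose quantile function is `q` (as a function of
`-log` of the level), then increments of `q` are those of the exponential function. -/
theorem quantile_eq_of_inDomainOfAttraction_compLog_dyadicDF {M q : ℝ → ℝ} {U : Set ℝ}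
    (hU : IsOpen U) (hc : ContinuousOn M U) (hm : StrictMonoOn M U)
    (hq : ∀ s, 0 < s → q s ∈ U ∧ M (q s) = Real.exp (-s))
    (h : InDomainOfAttraction (compLog dyadicDF) M) :
    q (1 / 4) - q (1 / 2) = Real.exp 1 * (q (1 / 2) - q 1) ∧
      q (1 / 2) - q (3 / 4) = Real.exp (1 / 2) * (q (3 / 4) - q 1) := by
  obtain ⟨a, b, ha, hab⟩ := h
  have key : ∀ c s : ℝ, 0 ≤ c → 0 < s →
      (∀ m : ℕ, dyadicTail (m + c) = s * (1 / 2 : ℝ) ^ m) →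
      Tendsto (fun m : ℕ => (Real.exp (m + c) - b (2 ^ m)) / a (2 ^ m)) atTop (𝓝 (q s)) := by
    intro c s hc0 hs ht
    refine tendsto_sub_div_of_tendsto_pow isDistributionFunction_compLog_dyadicDF.1
      compLog_dyadicDF_nonneg ha hab hU hc hm
      (hq s hs).1 (tendsto_pow_atTop_atTop_of_one_lt one_lt_two) ?_
    rw [(hq s hs).2]
    exact tendsto_compLog_dyadicDF_exp_pow hc0 ht
  have h0 := key 0 1 le_rfl one_pos dyadicTail_natCast_add_zero
  have h1 := key (1 / 2) (3 / 4) (by norm_num) (by norm_num) dyadicTail_natCast_add_half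
  have h2 := key 1 (1 / 2) (by norm_num) (by norm_num) dyadicTail_natCast_add_one
  have h3 := key 2 (1 / 4) (by norm_num) (by norm_num) dyadicTail_natCast_add_two
  -- A shift of the argument multiplies `exp`; after `b` cancels in the differences, this factor
  -- relates consecutive increments.
  have e1 : ∀ m : ℕ, Real.exp (m + 1) = Real.exp 1 * Real.exp (m + 0) := fun m => by
    rw [← Real.exp_add]; congr 1; ring
  have e2 : ∀ m : ℕ, Real.exp (m + 2) = Real.exp 1 * Real.exp (m + 1) := fun m => by
    rw [← Real.exp_add]; congr 1; ring
  have e3 : ∀ m : ℕ, Real.exp (m + 1 / 2) = Real.exp (1 / 2) * Real.exp (m + 0) := fun m => by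
    rw [← Real.exp_add]; congr 1; ring
  have e4 : ∀ m : ℕ, Real.exp (m + 1) = Real.exp (1 / 2) * Real.exp (m + 1 / 2) := fun m => by
    rw [← Real.exp_add]; congr 1; ring
  constructor
  · refine tendsto_nhds_unique ((h2.sub h0).const_mul (Real.exp 1) |>.congr fun m => ?_)
      (h3.sub h2) |>.symm
    rw [e2, mul_sub, mul_div_assoc', mul_div_assoc', mul_sub, mul_sub, ← e1]
    ring
  · refine tendsto_nhds_unique ((h1.sub h0).const_mul (Real.exp (1 / 2)) |>.congr fun m => ?_)
      (h2.sub h1) |>.symm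
    rw [e4, mul_sub, mul_div_assoc', mul_div_assoc', mul_sub, mul_sub, ← e3]
    ring

theorem strictMono_gumbel : StrictMono gumbel := fun _ _ h =>
  Real.exp_lt_exp.2 (neg_lt_neg (Real.exp_lt_exp.2 (neg_lt_neg h)))

theorem continuous_gumbel : Continuous gumbel := by unfold gumbel; fun_prop

theorem gumbel_neg_log {s : ℝ} (hs : 0 < s) : gumbel (-Real.log s) = Real.exp (-s) := by
  rw [gumbel, neg_neg, Real.exp_log hs]

theorem frechet_of_pos {γ x : ℝ} (hx : 0 < x) : frechet γ x = Real.exp (-(x ^ (-γ))) := if_pos hx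

theorem strictMonoOn_frechet {γ : ℝ} (hγ : 0 < γ) : StrictMonoOn (frechet γ) (Set.Ioi 0) := by
  intro x hx y hy h
  rw [frechet_of_pos hx, frechet_of_pos hy, Real.exp_lt_exp, neg_lt_neg_iff]
  exact Real.rpow_lt_rpow_of_neg hx h (by linarith)

theorem continuousOn_frechet (γ : ℝ) : ContinuousOn (frechet γ) (Set.Ioi 0) := by
  have : ContinuousOn (fun x : ℝ => Real.exp (-(x ^ (-γ)))) (Set.Ioi 0) := fun x hx =>
    ((Real.continuousAt_rpow_const x (-γ) (Or.inl (ne_of_gt hx))).neg.rexp).continuousWithinAt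
  exact this.congr fun x hx => frechet_of_pos hx

theorem frechet_inv_rpow {γ s : ℝ} (hγ : 0 < γ) (hs : 0 < s) :
    frechet γ ((s⁻¹) ^ γ⁻¹) = Real.exp (-s) := by
  rw [frechet_of_pos (by positivity), ← Real.rpow_mul (by positivity), mul_neg,
    inv_mul_cancel₀ hγ.ne', Real.rpow_neg_one, inv_inv]

theorem not_inDomainOfAttraction_dyadicDF_gumbel : ¬ InDomainOfAttraction dyadicDF gumbel := by
  intro h
  have := quantile_eq_of_inDomainOfAttraction_dyadicDF (q := fun s => -Real.log s) isOpen_univ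
    continuous_gumbel.continuousOn (strictMono_gumbel.strictMonoOn _)
    (fun s hs => ⟨Set.mem_univ _, gumbel_neg_log hs⟩) h
  -- Equidistance of the values `-log s` would mean `(3 / 4) ^ 2 = 1 / 2`.
  have h2 : Real.log ((3 / 4) ^ 2) = Real.log (1 / 2) := by
    rw [Real.log_pow]; simp only [Real.log_one] at this; push_cast; linarith
  have := Real.log_injOn_pos (by norm_num) (by norm_num) h2
  norm_num at this

theorem not_inFrechetDomain_dyadicDF : ¬ InFrechetDomain dyadicDF := by
  rintro ⟨γ, hγ, h⟩
  have := quantile_eq_of_inDomainOfAttraction_dyadicDF (q := fun s => (s⁻¹) ^ γ⁻¹) isOpen_Ioi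
    (continuousOn_frechet γ) (strictMonoOn_frechet hγ)
    (fun s hs => ⟨show (0 : ℝ) < _ by positivity, frechet_inv_rpow hγ hs⟩) h
  norm_num at this
  -- With `A = (4/3) ^ γ⁻¹` and `B = 2 ^ γ⁻¹`, equidistance reads `2 * A = 1 + B`. But `(4/3) ^ 2 <
  -- 2` gives `A ^ 2 < B`, hence `(A - 1) ^ 2 < 0`.
  have h1 : ((4 / 3 : ℝ) ^ γ⁻¹) ^ 2 < 2 ^ γ⁻¹ := by
    rw [← Real.rpow_natCast, ← Real.rpow_mul (by norm_num), mul_comm, Real.rpow_mul (by norm_num)]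
    exact Real.rpow_lt_rpow (by positivity) (by norm_num) (by positivity)
  nlinarith [sq_nonneg ((4 / 3 : ℝ) ^ γ⁻¹ - 1)]

theorem not_inDomainOfAttraction_compLog_dyadicDF_gumbel :
    ¬ InDomainOfAttraction (compLog dyadicDF) gumbel := by
  intro h
  have := (quantile_eq_of_inDomainOfAttraction_compLog_dyadicDF (q := fun s => -Real.log s)
    isOpen_univ continuous_gumbel.continuousOn (strictMono_gumbel.strictMonoOn _)
    (fun s hs => ⟨Set.mem_univ _, gumbel_neg_log hs⟩) h).1
  -- Halving `s` always increases `-log s` by `log 2`, whereas the increments should have ratio `exp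
  -- 1`.
  have h4 : Real.log (1 / 4) = 2 * Real.log (1 / 2) := by
    rw [show (1 / 4 : ℝ) = (1 / 2) ^ 2 by norm_num, Real.log_pow]; norm_num
  have h2 : Real.log (1 / 2) < 0 := Real.log_neg (by norm_num) (by norm_num)
  have he : 1 < Real.exp 1 := Real.one_lt_exp_iff.2 one_pos
  simp only [h4, Real.log_one] at this
  nlinarith

theorem not_inFrechetDomain_compLog_dyadicDF : ¬ InFrechetDomain (compLog dyadicDF) := by
  rintro ⟨γ, hγ, h⟩
  obtain ⟨h1, h2⟩ := quantile_eq_of_inDomainOfAttraction_compLog_dyadicDF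
    (q := fun s => (s⁻¹) ^ γ⁻¹) isOpen_Ioi (continuousOn_frechet γ) (strictMonoOn_frechet hγ)
    (fun s hs => ⟨show (0 : ℝ) < _ by positivity, frechet_inv_rpow hγ hs⟩) h
  have h4 : (4 : ℝ) ^ γ⁻¹ = (2 ^ γ⁻¹) ^ 2 := by
    rw [← Real.rpow_natCast, ← Real.rpow_mul (by norm_num), mul_comm, Real.rpow_mul (by norm_num)]
    norm_num
  have h5 : ((4 / 3 : ℝ) ^ γ⁻¹) ^ 2 < 2 ^ γ⁻¹ := by
    rw [← Real.rpow_natCast, ← Real.rpow_mul (by norm_num), mul_comm, Real.rpow_mul (by norm_num)]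
    exact Real.rpow_lt_rpow (by positivity) (by norm_num) (by positivity)
  have h6 : (1 : ℝ) < 2 ^ γ⁻¹ := Real.one_lt_rpow (by norm_num) (by positivity)
  have he : Real.exp 1 = Real.exp (1 / 2) ^ 2 := by
    rw [← Real.exp_nat_mul]; norm_num
  norm_num at h1 h2
  rw [h4] at h1
  -- The levels `1, 1/2, 1/4` determine `γ`; the level `3/4` then forces `(4/3) ^ γ⁻¹ = exp (1/2)`,
  -- contradicting `h5`.
  have h7 : (2 : ℝ) ^ γ⁻¹ = Real.exp 1 := by
    have : ((2 : ℝ) ^ γ⁻¹ - 1) * (2 ^ γ⁻¹ - Real.exp 1) = 0 := by linear_combination h1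
    rcases mul_eq_zero.1 this with h | h <;> linarith
  rw [h7, he] at h2
  rw [h7, he] at h5
  have hpos := Real.exp_pos (1 / 2)
  have h8 : (1 + Real.exp (1 / 2)) * ((4 / 3 : ℝ) ^ γ⁻¹ - Real.exp (1 / 2)) = 0 := by
    linear_combination -h2
  rcases mul_eq_zero.1 h8 with h | h
  · linarith
  · rw [sub_eq_zero.1 h] at h5
    exact lt_irrefl _ h5

/-! ### Order statistics and exceedance counts -/

/-- This reduces order statistics to sums of independent indicators. Sorting permutes the sample, so
it does not change the number of values at most `t`. -/
theorem orderStat_sub_le_iff {y : ℕ → ℝ} {j n : ℕ} (hj : j < n) (t : ℝ) :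
    orderStat y (n - j) n ≤ t ↔ ((Finset.range n).filter fun i => t < y i).card ≤ j := by
  classical
  rw [orderStat, dif_pos ⟨by omega, by omega⟩]
  have h := Tuple.lt_card_le_iff_apply_le_of_monotone (a := t) (j := ⟨n - j - 1, by omega⟩)
    (Tuple.monotone_sort fun i : Fin n => y i)
  simp only [Function.comp] at h
  rw [← h]
  have e1 : (Finset.univ.filter fun i : Fin n =>
      y (Tuple.sort (fun i : Fin n => y i) i) ≤ t).card
        = (Finset.univ.filter fun i : Fin n => y i ≤ t).card :=
    Finset.card_equiv (Tuple.sort fun i : Fin n => y i) (by simp)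
  have e2 : (Finset.univ.filter fun i : Fin n => y i ≤ t).card
      = ((Finset.range n).filter fun i => y i ≤ t).card := by
    refine Finset.card_bij (fun i _ => (i : ℕ)) ?_ ?_ ?_
    · simp
    · intro a _ b _ hab
      exact Fin.ext hab
    · intro b hb
      simp only [Finset.mem_filter, Finset.mem_range] at hb
      exact ⟨⟨b, hb.1⟩, by simpa using hb.2, rfl⟩
  have e3 := Finset.card_filter_add_card_filter_not (s := Finset.range n) (fun i => y i ≤ t)
  simp only [not_le, Finset.card_range] at e3
  simp only [e1, e2]
  omega

theorem sum_indicator_Ioi_eq_card (y : ℕ → ℝ) (t : ℝ) (n : ℕ) :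
    ∑ i ∈ Finset.range n, (Set.Ioi t).indicator (fun _ => (1 : ℝ)) (y i)
      = ((Finset.range n).filter fun i => t < y i).card := by
  simp [Set.indicator_apply]

theorem indicator_Ioi_comp {Ω : Type*} (t : ℝ) (f : Ω → ℝ) :
    (fun ω => (Set.Ioi t).indicator (fun _ => (1 : ℝ)) (f ω))
      = {ω | t < f ω}.indicator fun _ => 1 := by
  ext ω; simp [Set.indicator_apply]

theorem measurable_indicator_Ioi (t : ℝ) :
    Measurable ((Set.Ioi t).indicator fun _ => (1 : ℝ)) :=
  measurable_const.indicator measurableSet_Ioi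

section Exceedances

variable {Ω : Type*} [MeasurableSpace Ω] {μ : Measure Ω} {Y : ℕ → Ω → ℝ} {t p : ℝ}

theorem integral_indicator_Ioi_comp {f : Ω → ℝ} (hf : Measurable f) :
    ∫ ω, (Set.Ioi t).indicator (fun _ => (1 : ℝ)) (f ω) ∂μ = μ.real {ω | t < f ω} := by
  rw [indicator_Ioi_comp, integral_indicator_const _ (measurableSet_lt measurable_const hf)]
  simp

variable [IsProbabilityMeasure μ]

theorem integrable_indicator_Ioi_comp {f : Ω → ℝ} (hf : Measurable f) :
    Integrable (fun ω => (Set.Ioi t).indicator (fun _ => (1 : ℝ)) (f ω)) μ := by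
  rw [indicator_Ioi_comp]
  exact (integrable_const _).indicator (measurableSet_lt measurable_const hf)

/-- Markov bound for the upper tail of an upper order statistic. -/
theorem measureReal_lt_orderStat_sub_le (hm : ∀ i, Measurable (Y i))
    (hp : ∀ i, μ.real {ω | t < Y i ω} = p) {j n : ℕ} (hj : j < n) :
    ((j : ℝ) + 1) * μ.real {ω | t < orderStat (fun i => Y i ω) (n - j) n} ≤ n * p := by
  have hset : {ω | t < orderStat (fun i => Y i ω) (n - j) n}
      = {ω | (j : ℝ) + 1 ≤
          ∑ i ∈ Finset.range n, (Set.Ioi t).indicator (fun _ => (1 : ℝ)) (Y i ω)} := by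
    ext ω
    simp only [Set.mem_ofPred_eq]
    rw [← not_le, orderStat_sub_le_iff hj, sum_indicator_Ioi_eq_card, not_le]
    exact_mod_cast Nat.lt_iff_add_one_le
  rw [hset]
  refine (mul_meas_ge_le_integral_of_nonneg (Eventually.of_forall fun ω => ?_)
    (integrable_finsetSum _ fun i _ => integrable_indicator_Ioi_comp (hm i)) _).trans_eq ?_
  · exact Finset.sum_nonneg fun i _ => Set.indicator_nonneg (fun _ _ => zero_le_one) _
  · rw [integral_finsetSum _ fun i _ => integrable_indicator_Ioi_comp (hm i)]
    simp [integral_indicator_Ioi_comp (hm _), hp]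

/-- An indicator takes only the values `0` and `1`, so its exponential is affine in it; then `1 - x
≤ exp (-x)`. -/
theorem mgf_indicator_Ioi_comp_le {f : Ω → ℝ} (hf : Measurable f) :
    mgf (fun ω => (Set.Ioi t).indicator (fun _ => (1 : ℝ)) (f ω)) μ (-1)
      ≤ Real.exp (-((1 - Real.exp (-1)) * μ.real {ω | t < f ω})) := by
  have h : ∀ ω, Real.exp (-1 * (Set.Ioi t).indicator (fun _ => (1 : ℝ)) (f ω))
      = 1 - (1 - Real.exp (-1)) * (Set.Ioi t).indicator (fun _ => (1 : ℝ)) (f ω) := by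
    intro ω
    by_cases hω : f ω ∈ Set.Ioi t
    · rw [Set.indicator_of_mem hω]; ring_nf
    · rw [Set.indicator_of_notMem hω]; simp
  simp only [mgf, h]
  rw [integral_sub (integrable_const _) ((integrable_indicator_Ioi_comp hf).const_mul _),
    integral_const_mul, integral_indicator_Ioi_comp hf]
  have := Real.add_one_le_exp (-((1 - Real.exp (-1)) * μ.real {ω | t < f ω}))
  simp only [integral_const, probReal_univ, smul_eq_mul, mul_one]
  linarith

/-- Chernoff bound for the lower tail of an upper order statistic. -/
theorem measureReal_orderStat_sub_le_le (hm : ∀ i, Measurable (Y i)) (hi : iIndepFun Y μ)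
    (hp : ∀ i, μ.real {ω | t < Y i ω} = p) {j n : ℕ} (hj : j < n) :
    μ.real {ω | orderStat (fun i => Y i ω) (n - j) n ≤ t}
      ≤ Real.exp (j - (1 - Real.exp (-1)) * (n * p)) := by
  set Z : ℕ → Ω → ℝ := fun i ω => (Set.Ioi t).indicator (fun _ => (1 : ℝ)) (Y i ω) with hZ
  have hZm : ∀ i, Measurable (Z i) := fun i => (measurable_indicator_Ioi t).comp (hm i)
  have hZi : iIndepFun Z μ :=
    hi.comp (fun _ => (Set.Ioi t).indicator fun _ => (1 : ℝ)) fun _ => measurable_indicator_Ioi t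
  have hset : {ω | orderStat (fun i => Y i ω) (n - j) n ≤ t}
      = {ω | (∑ i ∈ Finset.range n, Z i) ω ≤ j} := by
    ext ω
    simp only [Set.mem_ofPred_eq, Finset.sum_apply, hZ]
    rw [orderStat_sub_le_iff hj, sum_indicator_Ioi_eq_card, Nat.cast_le]
  have hint : Integrable (fun ω => Real.exp (-1 * (∑ i ∈ Finset.range n, Z i) ω)) μ := by
    refine Integrable.of_bound (C := 1) (by fun_prop) (Eventually.of_forall fun ω => ?_)
    rw [Real.norm_eq_abs, Real.abs_exp, Real.exp_le_one_iff, Finset.sum_apply]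
    have : 0 ≤ ∑ i ∈ Finset.range n, Z i ω :=
      Finset.sum_nonneg fun i _ => Set.indicator_nonneg (fun _ _ => zero_le_one) _
    linarith
  rw [hset]
  -- The parameter `-1` need not be optimized: the bound is used only where `n * p` exceeds `j` by a
  -- factor tending to infinity.
  refine (measure_le_le_exp_mul_mgf (j : ℝ) (by norm_num : (-1 : ℝ) ≤ 0) hint).trans ?_
  have hmgf : mgf (∑ i ∈ Finset.range n, Z i) μ (-1)
      ≤ Real.exp (-((1 - Real.exp (-1)) * p)) ^ n := by
    rw [hZi.mgf_sum hZm]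
    refine (Finset.prod_le_prod (fun _ _ => mgf_nonneg) fun i _ =>
      mgf_indicator_Ioi_comp_le (hm i)).trans_eq ?_
    simp [hp]
  calc Real.exp (- -1 * (j : ℝ)) * mgf (∑ i ∈ Finset.range n, Z i) μ (-1)
      ≤ Real.exp (- -1 * (j : ℝ)) * Real.exp (-((1 - Real.exp (-1)) * p)) ^ n :=
        mul_le_mul_of_nonneg_left hmgf (Real.exp_pos _).le
    _ = _ := by
        rw [← Real.exp_nat_mul, ← Real.exp_add]
        congr 1; ring

end Exceedances

/-! ### Law of the logarithms and existence of the sequence -/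

/-- The logarithm of a variable with distribution function `compLog dyadicDF` has distribution
function `dyadicDF`. -/
theorem measureReal_lt_log {Ω : Type*} [MeasurableSpace Ω] {μ : Measure Ω}
    [IsProbabilityMeasure μ] {f : Ω → ℝ} (hf : Measurable f)
    (h : ∀ x, μ.real {ω | f ω ≤ x} = compLog dyadicDF x) (t : ℝ) :
    μ.real {ω | t < Real.log (f ω)} = 1 - dyadicDF t := by
  have h0 : ∀ᵐ ω ∂μ, 0 < f ω := by
    have h1 : μ.real {ω | f ω ≤ 0} = 0 := by
      rw [h, compLog_dyadicDF_of_le_one zero_le_one]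
    rw [measureReal_eq_zero_iff] at h1
    simpa [ae_iff] using h1
  have h2 : μ.real {ω | t < Real.log (f ω)} = μ.real {ω | f ω ≤ Real.exp t}ᶜ := by
    refine measureReal_congr ?_
    filter_upwards [h0] with ω hω
    refine propext ?_
    change t < Real.log (f ω) ↔ ¬ (f ω ≤ Real.exp t)
    rw [not_le, Real.lt_log_iff_exp_lt hω]
  rw [h2, probReal_compl_eq_one_sub (measurableSet_le hf measurable_const), h, compLog,
    if_pos (Real.exp_pos t), Real.log_exp]

/-- The two negative statements need an actual i.i.d. sequence, on a sample space in `Type`. -/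
theorem exists_isIIDWithDF {F : ℝ → ℝ} (hF : IsDistributionFunction F) :
    ∃ (Ω : Type) (_ : MeasurableSpace Ω) (μ : Measure Ω) (_ : IsProbabilityMeasure μ)
      (X : ℕ → Ω → ℝ), IsIIDWithDF μ X F := by
  let S : StieltjesFunction ℝ := ⟨F, hF.1, hF.2.1⟩
  have : IsProbabilityMeasure S.measure := S.isProbabilityMeasure hF.2.2.1 hF.2.2.2
  obtain ⟨Ω, mΩ, μ, X, hm, hl, hi, hμ⟩ := exists_iid ℕ S.measure
  refine ⟨Ω, mΩ, μ, hμ, X, hm, hi, fun i x => ?_⟩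
  rw [(hl i).measureReal_eq (p := fun y => y ≤ x) measurableSet_Iic, measureReal_def]
  change (S.measure (Set.Iic x)).toReal = F x
  rw [S.measure_Iic hF.2.2.1, sub_zero]
  exact ENNReal.toReal_ofReal (le_of_tendsto hF.2.2.1
    ((eventually_le_atBot x).mono fun _ hy => hF.1 hy))

/-! ### Convergence in probability of the statistic -/

/-- With `a = n`, `b = κ`, `c = k`, moving the threshold by `s * log k` multiplies the approximate
expected exceedance count `κ` by the power `k ^ (-(s * log 2))`. -/
theorem half_rpow_log_div_add {a b c : ℝ} (ha : 0 < a) (hb : 0 < b) (hc : 0 < c) (s : ℝ) :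
    (1 / 2 : ℝ) ^ (Real.log (a / b) / Real.log 2 + s * Real.log c)
      = b / a * c ^ (-(s * Real.log 2)) := by
  have h2 : Real.log 2 ≠ 0 := (Real.log_pos one_lt_two).ne'
  have hba : b / a = Real.exp (-Real.log (a / b)) := by
    rw [Real.exp_neg, Real.exp_log (by positivity), inv_div]
  rw [Real.rpow_def_of_pos (by norm_num), Real.rpow_def_of_pos hc, hba, ← Real.exp_add,
    one_div, Real.log_inv]
  congr 1
  field_simp
  ring

section Limit

variable {Ω : Type*} [MeasurableSpace Ω] {μ : Measure Ω} [IsProbabilityMeasure μ]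
  {Y : ℕ → Ω → ℝ} {k j κ : ℕ → ℕ} {s : ℝ}

/-- The auxiliary `κ` treats the maximum (`j = 0`, `κ = 1`) together with `j = κ = k`. The condition
`κ n ≤ j n + 1` lets the Markov factor `j + 1` absorb `κ`. -/
theorem tendsto_measureReal_lt_orderStat_sub (hm : ∀ i, Measurable (Y i))
    (hY : ∀ i t, μ.real {ω | t < Y i ω} = 1 - dyadicDF t)
    (hk : Tendsto k atTop atTop) (hκ : ∀ n, 0 < κ n) (hκj : ∀ n, κ n ≤ j n + 1)
    (hjn : ∀ᶠ n in atTop, j n < n) (hs : 0 < s) :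
    Tendsto (fun n : ℕ => μ.real {ω | Real.log ((n : ℝ) / κ n) / Real.log 2 + s * Real.log (k n) <
      orderStat (fun i => Y i ω) (n - j n) n}) atTop (𝓝 0) := by
  have hlim : Tendsto (fun n => 2 * (k n : ℝ) ^ (-(s * Real.log 2))) atTop (𝓝 (2 * 0)) :=
    ((tendsto_rpow_neg_atTop (mul_pos hs (Real.log_pos one_lt_two))).comp
      (tendsto_natCast_atTop_atTop.comp hk)).const_mul 2
  rw [mul_zero] at hlim
  refine squeeze_zero' (Eventually.of_forall fun n => measureReal_nonneg) ?_ hlim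
  filter_upwards [hjn, hk.eventually_gt_atTop 0] with n hn hkn
  have hn0 : (0 : ℝ) < n := by exact_mod_cast (Nat.zero_le _).trans_lt hn
  have hκ0 : (0 : ℝ) < κ n := by exact_mod_cast hκ n
  have hk0 : (0 : ℝ) < k n := by exact_mod_cast hkn
  have hκj' : (κ n : ℝ) ≤ j n + 1 := by exact_mod_cast hκj n
  set t := Real.log ((n : ℝ) / κ n) / Real.log 2 + s * Real.log (k n) with ht
  have h1 := measureReal_lt_orderStat_sub_le hm (fun i => hY i t) hn
  have h2 := one_sub_dyadicDF_le t
  rw [ht, half_rpow_log_div_add hn0 hκ0 hk0, ← ht] at h2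
  have h3 : (n : ℝ) * (1 - dyadicDF t) ≤ κ n * (2 * (k n : ℝ) ^ (-(s * Real.log 2))) := by
    refine (mul_le_mul_of_nonneg_left h2 hn0.le).trans_eq ?_
    field_simp
  refine le_of_mul_le_mul_left ?_ hκ0
  exact (mul_le_mul_of_nonneg_right hκj' measureReal_nonneg).trans (h1.trans h3)

theorem tendsto_measureReal_orderStat_sub_le (hm : ∀ i, Measurable (Y i)) (hi : iIndepFun Y μ)
    (hY : ∀ i t, μ.real {ω | t < Y i ω} = 1 - dyadicDF t)
    (hk : Tendsto k atTop atTop) (hκ : ∀ n, 0 < κ n) (hjκ : ∀ n, j n ≤ κ n)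
    (hκn : Tendsto (fun n : ℕ => (κ n : ℝ) / n) atTop (𝓝 0))
    (hjn : ∀ᶠ n in atTop, j n < n) (hs : 0 < s) :
    Tendsto (fun n : ℕ => μ.real {ω | orderStat (fun i => Y i ω) (n - j n) n ≤
      Real.log ((n : ℝ) / κ n) / Real.log 2 + -s * Real.log (k n)}) atTop (𝓝 0) := by
  set c : ℝ := 1 - Real.exp (-1) with hc
  have hc0 : 0 < c := by
    have : Real.exp (-1) < 1 := by rw [Real.exp_lt_one_iff]; norm_num
    linarith
  have hρ : Tendsto (fun n => (k n : ℝ) ^ (s * Real.log 2)) atTop atTop :=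
    (tendsto_rpow_atTop (mul_pos hs (Real.log_pos one_lt_two))).comp
      (tendsto_natCast_atTop_atTop.comp hk)
  have hν : Tendsto (fun n : ℕ => (n : ℝ) / κ n) atTop atTop := by
    have : Tendsto (fun n : ℕ => (κ n : ℝ) / n) atTop (𝓝[>] 0) := by
      refine tendsto_nhdsWithin_iff.2 ⟨hκn, ?_⟩
      filter_upwards [eventually_gt_atTop 0] with n hn
      have hn' : (0 : ℝ) < n := Nat.cast_pos.2 hn
      have hκ' : (0 : ℝ) < κ n := Nat.cast_pos.2 (hκ n)
      exact div_pos hκ' hn'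
    exact this.inv_tendsto_nhdsGT_zero.congr fun n => inv_div _ _
  -- The minimum appears because the tail is capped at `1` for negative thresholds; that cap is
  -- harmless since `n / κ → ∞`.
  have hmin : Tendsto (fun n : ℕ => 1 - c * min ((n : ℝ) / κ n) ((k n : ℝ) ^ (s * Real.log 2)))
      atTop atBot :=
    tendsto_atBot_add_const_left _ 1
      (tendsto_neg_atTop_atBot.comp ((tendsto_atTop.2 fun b => by
        filter_upwards [tendsto_atTop.1 hν b, tendsto_atTop.1 hρ b] with n h1 h2
          using le_min h1 h2).const_mul_atTop hc0))
  refine squeeze_zero' (Eventually.of_forall fun n => measureReal_nonneg) ?_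
    (Real.tendsto_exp_atBot.comp hmin)
  filter_upwards [hjn, hk.eventually_gt_atTop 0, hmin.eventually_le_atBot 0] with n hn hkn hle
  have hn0 : (0 : ℝ) < n := by exact_mod_cast (Nat.zero_le _).trans_lt hn
  have hκ0 : (0 : ℝ) < κ n := by exact_mod_cast hκ n
  have hκ1 : (1 : ℝ) ≤ κ n := by exact_mod_cast hκ n
  have hk0 : (0 : ℝ) < k n := by exact_mod_cast hkn
  have hjκ' : (j n : ℝ) ≤ κ n := by exact_mod_cast hjκ n
  set t := Real.log ((n : ℝ) / κ n) / Real.log 2 + -s * Real.log (k n) with ht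
  have h1 := measureReal_orderStat_sub_le_le hm hi (fun i => hY i t) hn
  have h2 := min_one_le_one_sub_dyadicDF t
  rw [ht, half_rpow_log_div_add hn0 hκ0 hk0, ← ht, neg_mul, neg_neg] at h2
  refine h1.trans (Real.exp_le_exp.2 ?_)
  set r := (k n : ℝ) ^ (s * Real.log 2)
  have h3 : (κ n : ℝ) * min ((n : ℝ) / κ n) r ≤ n * (1 - dyadicDF t) := by
    refine le_trans (le_of_eq ?_) (mul_le_mul_of_nonneg_left h2 hn0.le)
    rw [mul_min_of_nonneg _ _ hκ0.le, mul_min_of_nonneg _ _ hn0.le]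
    congr 1 <;> field_simp
  -- As `j ≤ κ`, the exponent is at most `κ` times the nonpositive quantity in `hle`, and `κ ≥ 1`
  -- can be dropped.
  have h4 := mul_le_mul_of_nonneg_left h3 hc0.le
  nlinarith

theorem tendsto_measureReal_abs_orderStat_sub (hm : ∀ i, Measurable (Y i)) (hi : iIndepFun Y μ)
    (hY : ∀ i t, μ.real {ω | t < Y i ω} = 1 - dyadicDF t)
    (hk : Tendsto k atTop atTop) (hκ : ∀ n, 0 < κ n) (hjκ : ∀ n, j n ≤ κ n)
    (hκj : ∀ n, κ n ≤ j n + 1) (hκn : Tendsto (fun n : ℕ => (κ n : ℝ) / n) atTop (𝓝 0))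
    (hjn : ∀ᶠ n in atTop, j n < n) (hs : 0 < s) :
    Tendsto (fun n : ℕ => μ.real {ω | s * Real.log (k n) <
      |orderStat (fun i => Y i ω) (n - j n) n - Real.log ((n : ℝ) / κ n) / Real.log 2|})
      atTop (𝓝 0) := by
  have h := (tendsto_measureReal_lt_orderStat_sub hm hY hk hκ hκj hjn hs).add
    (tendsto_measureReal_orderStat_sub_le hm hi hY hk hκ hjκ hκn hjn hs)
  rw [add_zero] at h
  refine squeeze_zero (fun n => measureReal_nonneg) (fun n => ?_) h
  refine (measureReal_mono fun ω hω => ?_).trans (measureReal_union_le _ _)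
  simp only [Set.mem_union, Set.mem_ofPred_eq] at hω ⊢
  rcases lt_abs.1 hω with h | h
  · left; linarith
  · right; linarith

theorem tendsto_measureReal_deHaanResnick (hm : ∀ i, Measurable (Y i)) (hi : iIndepFun Y μ)
    (hY : ∀ i t, μ.real {ω | t < Y i ω} = 1 - dyadicDF t) (hk : ConditionK k) {ε : ℝ}
    (hε : 0 < ε) :
    Tendsto (fun n => μ.real {ω |
      ε ≤ |deHaanResnick (fun i => Y i ω) n (k n) - 1 / Real.log 2|}) atTop (𝓝 0) := by
  have hkn : ∀ᶠ n in atTop, k n < n := by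
    filter_upwards [hk.2.eventually_lt_const one_pos, eventually_gt_atTop 0] with n h hn
    rw [div_lt_one (by exact_mod_cast hn)] at h
    exact_mod_cast h
  have hmax := tendsto_measureReal_abs_orderStat_sub (j := fun _ => 0) (κ := fun _ => 1)
    hm hi hY hk.1 (fun _ => one_pos) (fun _ => zero_le_one) (fun _ => le_rfl)
    (by simpa using tendsto_inv_atTop_nhds_zero_nat (𝕜 := ℝ)) (eventually_gt_atTop 0)
    (show 0 < ε / 3 by positivity)
  -- The maximum with `1` secures `κ n > 0` for every `n`; it equals `k n` eventually.
  have hint := tendsto_measureReal_abs_orderStat_sub (j := fun n => max (k n) 1)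
    (κ := fun n => max (k n) 1)
    hm hi hY hk.1 (fun _ => by positivity) (fun _ => le_rfl) (fun _ => Nat.le_succ _)
    (hk.2.congr' (by
      filter_upwards [hk.1.eventually_ge_atTop 1] with n hn
      rw [max_eq_left hn]))
    (by filter_upwards [hkn, hk.1.eventually_ge_atTop 1] with n hn h1 using by omega)
    (show 0 < ε / 3 by positivity)
  have h := hmax.add hint
  rw [add_zero] at h
  refine squeeze_zero' (Eventually.of_forall fun n => measureReal_nonneg) ?_ h
  filter_upwards [hkn, hk.1.eventually_ge_atTop 2] with n hn h2
  refine (measureReal_mono fun ω hω => ?_).trans (measureReal_union_le _ _)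
  have hk1 : (1 : ℝ) < k n := by exact_mod_cast h2
  have hn0 : (0 : ℝ) < n := by exact_mod_cast (Nat.zero_le _).trans_lt hn
  have hlog := Real.log_pos hk1
  by_contra hcon
  simp only [Set.mem_union, Set.mem_ofPred_eq, not_or, not_lt,
    max_eq_left (by omega : 1 ≤ k n), Nat.sub_zero, Nat.cast_one, div_one] at hcon
  obtain ⟨hA, hB⟩ := hcon
  rw [Real.log_div hn0.ne' (by positivity)] at hB
  set A := orderStat (fun i => Y i ω) n n
  set B := orderStat (fun i => Y i ω) (n - k n) n
  have hω' : ε ≤ |(A - B) / Real.log (k n) - 1 / Real.log 2| := hω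
  -- The centerings differ by `log k / log 2`, exactly the limit after division; two errors below `ε
  -- / 3` remain.
  have heq : (A - B) / Real.log (k n) - 1 / Real.log 2
      = ((A - Real.log n / Real.log 2)
        - (B - (Real.log n - Real.log (k n)) / Real.log 2)) / Real.log (k n) := by
    field_simp
    ring
  rw [heq, abs_div, abs_of_pos hlog, le_div_iff₀ hlog] at hω'
  have := abs_sub (A - Real.log n / Real.log 2)
    (B - (Real.log n - Real.log (k n)) / Real.log 2)
  nlinarith [mul_pos hε hlog]

end Limit

theorem convergesForAllK_of_isIIDWithDF {Ω : Type*} [MeasurableSpace Ω] {μ : Measure Ω}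
    [IsProbabilityMeasure μ] {X : ℕ → Ω → ℝ} (hX : IsIIDWithDF μ X (compLog dyadicDF)) :
    ConvergesForAllK μ X deHaanResnick (1 / Real.log 2) := by
  intro k hk
  rw [tendstoInMeasure_iff_measureReal_norm]
  intro ε hε
  exact tendsto_measureReal_deHaanResnick (Y := fun i ω => Real.log (X i ω))
    (fun i => Real.measurable_log.comp (hX.1 i))
    (hX.2.1.comp (fun _ => Real.log) fun _ => Real.measurable_log)
    (fun i t => measureReal_lt_log (hX.1 i) (hX.2.2 i) t) hk hε

theorem mainTheorem4 :
    -- the distribution function `G`, given by its quantile function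
    (∃ G : ℝ → ℝ, IsDistributionFunction G ∧
      (∀ m : ℕ, quantile G (1 - (1 / 2 : ℝ) ^ m) = m) ∧
      (∀ (m : ℕ) (u : ℝ), (1 / 2 : ℝ) ^ (m + 1) < u → u < (1 / 2 : ℝ) ^ m →
        quantile G (1 - u) = m + ((1 / 2 : ℝ) ^ m - u) * 2 ^ (m + 1)) ∧
      IsDistributionFunction (compLog G) ∧ compLog G 1 = 0 ∧
      -- the domains of attraction
      ¬ InFrechetDomain (compLog G) ∧ ¬ InDomainOfAttraction (compLog G) gumbel ∧
      ¬ InFrechetDomain G ∧ ¬ InDomainOfAttraction G gumbel ∧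
      -- the convergence in probability
      ∀ (Ω : Type*) (_ : MeasurableSpace Ω) (μ : Measure Ω) (_ : IsProbabilityMeasure μ)
        (X : ℕ → Ω → ℝ), IsIIDWithDF μ X (compLog G) →
        ConvergesForAllK μ X deHaanResnick (1 / Real.log 2)) ∧
    -- convergence to a positive real number does not imply `F ∈ D(φ)`
    (¬ ∀ (Ω : Type) (_ : MeasurableSpace Ω) (μ : Measure Ω) (_ : IsProbabilityMeasure μ)
        (X : ℕ → Ω → ℝ) (F : ℝ → ℝ), IsIIDWithDF μ X F → F 1 = 0 →
        (∃ c : ℝ, 0 < c ∧ ConvergesForAllK μ X deHaanResnick c) → InFrechetDomain F) ∧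
    -- no empirical characterization
    ¬ EmpiricallyCharacterizesFrechet deHaanResnick (Real.log 2) := by
  obtain ⟨Ω, mΩ, μ, hμ, X, hX⟩ := exists_isIIDWithDF isDistributionFunction_compLog_dyadicDF
  have hlog : 0 < Real.log 2 := Real.log_pos one_lt_two
  have h1 : compLog dyadicDF 1 = 0 := compLog_dyadicDF_of_le_one le_rfl
  refine ⟨⟨dyadicDF, isDistributionFunction_dyadicDF, quantile_dyadicDF_natCast,
    fun m u => quantile_dyadicDF_of_mem_Ioo, isDistributionFunction_compLog_dyadicDF, h1,
    not_inFrechetDomain_compLog_dyadicDF, not_inDomainOfAttraction_compLog_dyadicDF_gumbel,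
    not_inFrechetDomain_dyadicDF, not_inDomainOfAttraction_dyadicDF_gumbel,
    fun _ _ _ _ _ h => convergesForAllK_of_isIIDWithDF h⟩, fun h => ?_, fun h => ?_⟩
  · exact not_inFrechetDomain_compLog_dyadicDF (h Ω mΩ μ hμ X _ hX h1
      ⟨_, one_div_pos.2 hlog, convergesForAllK_of_isIIDWithDF hX⟩)
  · exact not_inFrechetDomain_compLog_dyadicDF ⟨_, hlog,
      (h Ω mΩ μ hμ X _ hX h1).2 (convergesForAllK_of_isIIDWithDF hX)⟩
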